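/- Let $\lambda$ be Lebesgue measure on $[0,1]$ and let $T$ be a conditional expectation on the real space $L^\infty([0,1],\mathcal{B}([0,1]),\lambda)$, i.e. there is a sub-$\sigma$-algebra $\mathcal{G}\subseteq\mathcal{B}([0,1])$ with $Tf=\mathbb{E}(f\mid\mathcal{G})$ almost everywhere for all $f\in L^\infty$. Call $f\in L^\infty$ decreasing (increasing) if it agrees almost everywhere with a weakly decreasing (weakly increasing) function $[0,1]\to\mathbb{R}$. Say that $T$ preserves (reverses) monotonicity if $Tf$ is decreasing (increasing) for every decreasing $f\in L^\infty$. Then $T$ preserves or reverses monotonicity if and only if there is a countable (possibly finite or empty) family of pairwise disjoint nonempty open intervals $((a_k,b_k))_{k\in\mathcal{I}}$ in $(0,1)$, i.e. $0\le a_k<b_k\le 1$, such that, with $P:=\bigcup_{k\in\mathcal{I}}(a_k,b_k)$, for every $f\in L^\infty$ and almost every $u\in[0,1]$, $$Tf(u)=\sum_{k\in\mathcal{I}}\mathbf{1}_{(a_k,b_k)}(u)\,\frac{1}{b_k-a_k}\int_{a_k}^{b_k}f(t)\,dt+\mathbf{1}_{P^c}(u)\,f(u).$$ -/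

import Mathlib

open MeasureTheory Set
open scoped ENNReal unitInterval

/-- The space `L^∞([0, 1], 𝓑([0, 1]), λ)` of real-valued essentially bounded functions. -/
abbrev LInf : Type := Lp ℝ ∞ (volume : Measure I)

/-- `T` is a conditional expectation on `L^∞([0, 1])`: for some sub-σ-algebra `𝒢` of the Borel
σ-algebra of `[0, 1]`, `T f = 𝔼(f | 𝒢)` holds almost everywhere, for every `f`. -/
def IsConditionalExpectation (T : LInf →ₗ[ℝ] LInf) : Prop :=
  ∃ 𝒢 : MeasurableSpace I, 𝒢 ≤ borel I ∧
    ∀ f : LInf, (T f : I → ℝ) =ᵐ[volume] volume[(f : I → ℝ) | 𝒢]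

/-- `f` agrees almost everywhere with a (weakly) decreasing function `[0, 1] → ℝ`. -/
def IsDecreasing (f : LInf) : Prop :=
  ∃ g : I → ℝ, Antitone g ∧ (f : I → ℝ) =ᵐ[volume] g

/-- `f` agrees almost everywhere with a (weakly) increasing function `[0, 1] → ℝ`. -/
def IsIncreasing (f : LInf) : Prop :=
  ∃ g : I → ℝ, Monotone g ∧ (f : I → ℝ) =ᵐ[volume] g

/-- `T` maps decreasing functions to decreasing functions. -/
def MonotonicityPreserving (T : LInf →ₗ[ℝ] LInf) : Prop :=
  ∀ f : LInf, IsDecreasing f → IsDecreasing (T f)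

/-- `T` maps decreasing functions to increasing functions. -/
def MonotonicityReversing (T : LInf →ₗ[ℝ] LInf) : Prop :=
  ∀ f : LInf, IsDecreasing f → IsIncreasing (T f)

/-! Since `T` is idempotent, reversing implies preserving, so only preserving operators matter. The
whole structure is read off from a monotone version `h` of `T LInf.id`; the intervals are the
interiors of its nondegenerate level sets. On such an interval `h` is constant. For `f`
`L`-Lipschitz, both `f - L·id` and `-f - L·id` are decreasing, hence so are their images; as `L·h`
is constant there, `T f` is both decreasing and increasing, thus constant
(`MonotonicityPreserving.exists_ae_eq_const`). Lipschitz functions determine measures, so `T`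
averages every function there (`condExp_ae_eq_average_of_forall_lipschitz`). Off the intervals `h`
separates points up to null sets, so the σ-algebra, completed within the Borel sets, contains every
Borel subset of the complement, and `T` is the identity there. Conversely, the average of a
decreasing function lies between its endpoint values, so averaging over disjoint intervals preserves
the order. -/

/-! ### Conditional expectations: null sets and averaging -/

/-- Conditional expectations are unchanged by enlarging the σ-algebra by null sets. -/
theorem condExp_ae_eq_of_forall_ae_eq {α : Type*} {m m' m0 : MeasurableSpace α} {μ : Measure α}
    [IsFiniteMeasure μ] (hm : m ≤ m') (hm' : m' ≤ m0)
    (h : ∀ s, MeasurableSet[m'] s → ∃ t, MeasurableSet[m] t ∧ s =ᵐ[μ] t)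
    (f : α → ℝ) : μ[f | m] =ᵐ[μ] μ[f | m'] := by
  by_cases hf : Integrable f μ
  swap
  · rw [condExp_of_not_integrable hf, condExp_of_not_integrable hf]
  refine ae_eq_condExp_of_forall_setIntegral_eq hm' hf
    (fun _ _ _ => integrable_condExp.integrableOn) (fun s hs _ => ?_)
    (stronglyMeasurable_condExp.mono hm).aestronglyMeasurable
  obtain ⟨t, ht, hst⟩ := h s hs
  rw [setIntegral_congr_set hst, setIntegral_congr_set hst,
    setIntegral_condExp (hm.trans hm') hf ht]

/-- A conditional expectation on `L^∞([0, 1])` can be taken with respect to a σ-algebra which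
contains every Borel set that is almost everywhere equal to one of its members. -/
theorem IsConditionalExpectation.exists_complete {T : LInf →ₗ[ℝ] LInf}
    (hT : IsConditionalExpectation T) :
    ∃ m : MeasurableSpace I, m ≤ Subtype.instMeasurableSpace ∧
      (∀ s t : Set I, MeasurableSet[Subtype.instMeasurableSpace] s → MeasurableSet[m] t → s =ᵐ[volume] t →
        MeasurableSet[m] s) ∧
      ∀ f : LInf, (T f : I → ℝ) =ᵐ[volume] volume[(f : I → ℝ) | m] := by
  obtain ⟨𝒢, h𝒢, hT⟩ := hT
  have hb : borel I = Subtype.instMeasurableSpace := BorelSpace.measurable_eq.symm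
  rw [hb] at h𝒢
  -- Completing adds non-Borel null sets too; the infimum discards them.
  refine ⟨eventuallyMeasurableSpace 𝒢 (ae volume) ⊓ Subtype.instMeasurableSpace, inf_le_right,
    fun s t hs ht hst => ?_, fun f => (hT f).trans ?_⟩
  · obtain ⟨⟨t', ht', htt'⟩, -⟩ := MeasurableSpace.measurableSet_inf.1 ht
    exact MeasurableSpace.measurableSet_inf.2 ⟨⟨t', ht', hst.trans htt'⟩, hs⟩
  · refine condExp_ae_eq_of_forall_ae_eq (le_inf le_eventuallyMeasurableSpace h𝒢) inf_le_right
      (fun s hs => ?_) _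
    exact (MeasurableSpace.measurableSet_inf.1 hs).1

/-- Probability measures are determined by the integrals of Lipschitz functions. -/
theorem MeasureTheory.Measure.ext_of_forall_lipschitz {Ω : Type*} [MeasurableSpace Ω]
    [PseudoEMetricSpace Ω] [BorelSpace Ω] (μ ν : Measure Ω) [IsProbabilityMeasure μ]
    [IsProbabilityMeasure ν]
    (h : ∀ f : Ω → ℝ, (∃ C : ℝ, ∀ x y, dist (f x) (f y) ≤ C) → (∃ L, LipschitzWith L f) →
      ∫ x, f x ∂μ = ∫ x, f x ∂ν) : μ = ν := by
  let μ' : ProbabilityMeasure Ω := ⟨μ, inferInstance⟩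
  let ν' : ProbabilityMeasure Ω := ⟨ν, inferInstance⟩
  -- Weak convergence is tested on bounded Lipschitz functions, and weak limits are unique.
  have key : Filter.Tendsto (fun _ : ℕ => μ') Filter.atTop (nhds ν') := by
    rw [tendsto_iff_forall_lipschitz_integral_tendsto]
    intro f hb hL
    simp only [μ', ν', ProbabilityMeasure.coe_mk, h f hb hL]
    exact tendsto_const_nhds
  have hμν : μ' = ν' :=
    tendsto_nhds_unique (f := fun _ : ℕ => μ') (X := ProbabilityMeasure Ω) tendsto_const_nhds key
  exact congrArg Subtype.val hμν

/-- A function which is a.e. both increasing and decreasing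
on a set is a.e. constant there. -/
theorem exists_ae_eq_const_of_antitone_of_monotone {α : Type*} [MeasurableSpace α]
    [LinearOrder α] {μ : Measure α} {f g g' : α → ℝ} (hg : Antitone g) (hg' : Monotone g')
    (h : f =ᵐ[μ] g) (h' : f =ᵐ[μ] g') : ∃ c, f =ᵐ[μ] fun _ => c := by
  by_cases hS : ∃ x, f x = g x ∧ f x = g' x
  · obtain ⟨x, hx, hx'⟩ := hS
    refine ⟨f x, ?_⟩
    filter_upwards [h, h'] with y hy hy'
    rcases le_total x y with hxy | hxy
    · exact le_antisymm (by rw [hx, hy]; exact hg hxy) (by rw [hx', hy']; exact hg' hxy)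
    · exact le_antisymm (by rw [hx', hy']; exact hg' hxy) (by rw [hx, hy]; exact hg hxy)
  · refine ⟨0, ?_⟩
    filter_upwards [h, h'] with y hy hy'
    exact (hS ⟨y, hy, hy'⟩).elim

/-- If the `m`-conditional expectation of every Lipschitz function is a.e. constant on an
`m`-measurable set `A`, then conditional expectations of all functions are averages on `A`. -/
theorem condExp_ae_eq_average_of_forall_lipschitz {Ω : Type*} {m m0 : MeasurableSpace Ω}
    [PseudoEMetricSpace Ω] [BorelSpace Ω] {μ : Measure Ω} [IsFiniteMeasure μ] (hm : m ≤ m0)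
    {A : Set Ω} (hA : MeasurableSet[m] A)
    (h : ∀ f : Ω → ℝ, (∃ C : ℝ, ∀ x y, dist (f x) (f y) ≤ C) → (∃ L, LipschitzWith L f) →
      Integrable f μ ∧ ∃ c, μ[f | m] =ᵐ[μ.restrict A] fun _ => c)
    {f : Ω → ℝ} (hf : Integrable f μ) :
    μ[f | m] =ᵐ[μ.restrict A] fun _ => (μ.real A)⁻¹ * ∫ x in A, f x ∂μ := by
  -- Every non-null `m`-measurable piece of `A` carries the same normalised measure, since each
  -- Lipschitz `g` has the same mean `c` on all of them.
  have hcond : ∀ B, MeasurableSet[m] B → μ (B ∩ A) ≠ 0 →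
      ProbabilityTheory.cond μ (B ∩ A) = ProbabilityTheory.cond μ A := by
    intro B hB hBA
    have hA0 : μ A ≠ 0 := fun h0 => hBA (measure_mono_null inter_subset_right h0)
    have := ProbabilityTheory.cond_isProbabilityMeasure hBA
    have := ProbabilityTheory.cond_isProbabilityMeasure hA0
    refine Measure.ext_of_forall_lipschitz _ _ fun g hb hL => ?_
    obtain ⟨hg, c, hc⟩ := h g hb hL
    have key : ∀ S, S ⊆ A → MeasurableSet[m] S → μ S ≠ 0 →
        ∫ x, g x ∂(ProbabilityTheory.cond μ S) = c := by
      intro S hSA hS hS0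
      rw [ProbabilityTheory.cond, integral_smul_measure, ← setIntegral_condExp hm hg hS,
        integral_congr_ae (ae_restrict_of_ae_restrict_of_subset hSA hc), integral_const,
        measureReal_restrict_apply_univ, smul_eq_mul, smul_eq_mul, ← mul_assoc,
        ENNReal.toReal_inv, measureReal_def, inv_mul_cancel₀, one_mul]
      exact ENNReal.toReal_ne_zero.2 ⟨hS0, measure_ne_top _ _⟩
    rw [key _ inter_subset_right (hB.inter hA) hBA, key _ subset_rfl hA hA0]
  have hint : ∀ B, MeasurableSet[m] B → ∫ x in B ∩ A, f x ∂μ =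
      μ.real (B ∩ A) * ((μ.real A)⁻¹ * ∫ x in A, f x ∂μ) := by
    intro B hB
    by_cases h0 : μ (B ∩ A) = 0
    · rw [Measure.restrict_eq_zero.2 h0, integral_zero_measure, measureReal_def, h0]; simp
    · have := congrArg (fun ν => ∫ x, f x ∂ν) (hcond B hB h0)
      simp only [ProbabilityTheory.cond, integral_smul_measure, smul_eq_mul,
        ENNReal.toReal_inv] at this
      rw [measureReal_def, measureReal_def, ← this, mul_inv_cancel_left₀]
      exact ENNReal.toReal_ne_zero.2 ⟨h0, measure_ne_top _ _⟩
  set c := (μ.real A)⁻¹ * ∫ x in A, f x ∂μ with hc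
  have h1 : A.indicator (fun _ => c) =ᵐ[μ] μ[A.indicator f | m] := by
    refine ae_eq_condExp_of_forall_setIntegral_eq hm (hf.indicator (hm _ hA))
      (fun _ _ _ => ((integrable_const c).indicator (hm _ hA)).integrableOn) (fun B hB _ => ?_)
      (stronglyMeasurable_const.indicator hA).aestronglyMeasurable
    rw [setIntegral_indicator (hm _ hA), setIntegral_indicator (hm _ hA), hint B hB]
    simp
  rw [Filter.EventuallyEq, ae_restrict_iff' (hm _ hA)]
  filter_upwards [h1, condExp_indicator hf hA] with x hx hx' hxA
  rw [← hx, indicator_of_mem hxA, indicator_of_mem hxA] at hx'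
  exact hx'.symm

/-! ### Averaging over disjoint intervals -/

theorem tsum_indicator_add_indicator_of_mem {α ι : Type*} {s : ι → Set α}
    (hs : Pairwise (fun j k => Disjoint (s j) (s k))) (c : ι → ℝ) (f : α → ℝ) {u : α} {k : ι}
    (hu : u ∈ s k) :
    (∑' j, (s j).indicator (fun _ => c j) u) + (⋃ j, s j)ᶜ.indicator f u = c k := by
  rw [tsum_eq_single k fun j hj => indicator_of_notMem (disjoint_right.1 (hs hj) hu) _,
    indicator_of_mem hu, indicator_of_notMem (notMem_compl_iff.2 (mem_iUnion_of_mem k hu)), add_zero]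

theorem tsum_indicator_add_indicator_of_notMem {α ι : Type*} {s : ι → Set α} (c : ι → ℝ)
    (f : α → ℝ) {u : α} (hu : u ∉ ⋃ j, s j) :
    (∑' j, (s j).indicator (fun _ => c j) u) + (⋃ j, s j)ᶜ.indicator f u = f u := by
  have h : ∀ j, (s j).indicator (fun _ => c j) u = 0 := fun j =>
    indicator_of_notMem (fun hj => hu (mem_iUnion_of_mem j hj)) _
  simp only [h, tsum_zero, zero_add]
  exact indicator_of_mem hu f

theorem volumeReal_Ioo_unitInterval {a b : I} (hab : a < b) :
    (volume : Measure I).real (Ioo a b) = (b : ℝ) - a := by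
  rw [measureReal_def, unitInterval.volume_Ioo,
    ENNReal.toReal_ofReal (sub_nonneg.2 (Subtype.coe_le_coe.2 hab.le))]

theorem Antitone.integrable_unitInterval {g : I → ℝ} (hg : Antitone g) :
    Integrable g (volume : Measure I) :=
  integrableOn_univ.1 ((hg.antitoneOn univ).integrableOn_isCompact isCompact_univ)

theorem Antitone.le_average_Ioo {g : I → ℝ} (hg : Antitone g) {a b : I} (hab : a < b) :
    g b ≤ 1 / ((b : ℝ) - a) * ∫ t in Ioo a b, g t := by
  have hpos : (0 : ℝ) < b - a := sub_pos.2 (Subtype.coe_lt_coe.2 hab)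
  rw [one_div, le_inv_mul_iff₀ hpos, ← volumeReal_Ioo_unitInterval hab, ← smul_eq_mul,
    ← setIntegral_const]
  exact setIntegral_mono_on (integrable_const _).integrableOn hg.integrable_unitInterval.integrableOn
    measurableSet_Ioo fun t ht => hg ht.2.le

theorem Antitone.average_Ioo_le {g : I → ℝ} (hg : Antitone g) {a b : I} (hab : a < b) :
    1 / ((b : ℝ) - a) * ∫ t in Ioo a b, g t ≤ g a := by
  have hpos : (0 : ℝ) < b - a := sub_pos.2 (Subtype.coe_lt_coe.2 hab)
  rw [one_div, inv_mul_le_iff₀ hpos, ← volumeReal_Ioo_unitInterval hab, ← smul_eq_mul,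
    ← setIntegral_const]
  exact setIntegral_mono_on hg.integrable_unitInterval.integrableOn (integrable_const _).integrableOn
    measurableSet_Ioo fun t ht => hg ht.1.le

theorem le_of_disjoint_Ioo {α : Type*} [LinearOrder α] [DenselyOrdered α] {a b c d u v : α}
    (h : Disjoint (Ioo a b) (Ioo c d)) (hu : u ∈ Ioo a b) (hv : v ∈ Ioo c d) (huv : u ≤ v) :
    b ≤ c := by
  by_contra! hcb
  obtain ⟨z, hz, hz'⟩ := exists_between
    (show max a c < min b d by
      simp only [max_lt_iff, lt_min_iff]
      exact ⟨⟨hu.1.trans hu.2, hcb⟩, hu.1.trans_le (huv.trans hv.2.le), hv.1.trans hv.2⟩)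
  simp only [max_lt_iff, lt_min_iff] at hz hz'
  exact disjoint_left.1 h ⟨hz.1, hz'.1⟩ ⟨hz.2, hz'.2⟩

/-- Averaging a decreasing function over disjoint intervals yields a decreasing function. -/
theorem Antitone.average_on_Ioo {ι : Type*} {a b : ι → I} (hab : ∀ k, a k < b k)
    (hd : Pairwise (fun j k => Disjoint (Ioo (a j) (b j)) (Ioo (a k) (b k))))
    {g : I → ℝ} (hg : Antitone g) :
    Antitone fun u =>
      (∑' k, (Ioo (a k) (b k)).indicator
        (fun _ => 1 / ((b k : ℝ) - (a k : ℝ)) * ∫ t in Ioo (a k) (b k), g t) u) +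
      (⋃ k, Ioo (a k) (b k))ᶜ.indicator g u := by
  intro u v huv
  simp only
  by_cases hu : u ∈ ⋃ k, Ioo (a k) (b k) <;> by_cases hv : v ∈ ⋃ k, Ioo (a k) (b k)
  · obtain ⟨j, hj⟩ := mem_iUnion.1 hu
    obtain ⟨k, hk⟩ := mem_iUnion.1 hv
    rw [tsum_indicator_add_indicator_of_mem hd _ _ hj,
      tsum_indicator_add_indicator_of_mem hd _ _ hk]
    rcases eq_or_ne j k with rfl | hjk
    · exact le_rfl
    · exact (hg.average_Ioo_le (hab k)).trans
        ((hg (le_of_disjoint_Ioo (hd hjk) hj hk huv)).trans (hg.le_average_Ioo (hab j)))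
  · obtain ⟨j, hj⟩ := mem_iUnion.1 hu
    rw [tsum_indicator_add_indicator_of_mem hd _ _ hj,
      tsum_indicator_add_indicator_of_notMem _ _ hv]
    have hle : b j ≤ v := not_lt.1 fun h => hv (mem_iUnion_of_mem j ⟨hj.1.trans_le huv, h⟩)
    exact (hg hle).trans (hg.le_average_Ioo (hab j))
  · obtain ⟨k, hk⟩ := mem_iUnion.1 hv
    rw [tsum_indicator_add_indicator_of_mem hd _ _ hk,
      tsum_indicator_add_indicator_of_notMem _ _ hu]
    have hle : u ≤ a k := not_lt.1 fun h => hu (mem_iUnion_of_mem k ⟨h, huv.trans_lt hk.2⟩)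
    exact (hg.average_Ioo_le (hab k)).trans (hg hle)
  · rw [tsum_indicator_add_indicator_of_notMem _ _ hu,
      tsum_indicator_add_indicator_of_notMem _ _ hv]
    exact hg huv

theorem MonotonicityPreserving.of_average_on_Ioo {T : LInf →ₗ[ℝ] LInf} {ι : Type*}
    {a b : ι → I} (hab : ∀ k, a k < b k)
    (hd : Pairwise (fun j k => Disjoint (Ioo (a j) (b j)) (Ioo (a k) (b k))))
    (hT : ∀ f : LInf, (T f : I → ℝ) =ᵐ[volume] fun u =>
      (∑' k, (Ioo (a k) (b k)).indicator
        (fun _ => 1 / ((b k : ℝ) - (a k : ℝ)) * ∫ t in Ioo (a k) (b k), f t) u) +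
      (⋃ k, Ioo (a k) (b k))ᶜ.indicator (fun v => f v) u) :
    MonotonicityPreserving T := by
  rintro f ⟨g, hg, hfg⟩
  refine ⟨_, hg.average_on_Ioo hab hd, (hT f).trans ?_⟩
  have hint : ∀ k, ∫ t in Ioo (a k) (b k), f t = ∫ t in Ioo (a k) (b k), g t := fun k =>
    integral_congr_ae (ae_restrict_of_ae hfg)
  filter_upwards [hfg] with u hu
  simp only [hint]
  congr 1
  simp only [indicator, hu]

/-! ### From reversing to preserving -/

theorem IsConditionalExpectation.apply_apply {T : LInf →ₗ[ℝ] LInf}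
    (hT : IsConditionalExpectation T) (f : LInf) : T (T f) = T f := by
  obtain ⟨m, hm, -, h⟩ := hT.exists_complete
  refine Lp.ext ((h (T f)).trans ?_)
  refine (condExp_congr_ae (h f)).trans ((Filter.EventuallyEq.of_eq ?_).trans (h f).symm)
  exact condExp_of_stronglyMeasurable hm stronglyMeasurable_condExp integrable_condExp

theorem IsIncreasing.isDecreasing_neg {f : LInf} (hf : IsIncreasing f) : IsDecreasing (-f) := by
  obtain ⟨g, hg, hfg⟩ := hf
  exact ⟨-g, hg.neg, (Lp.coeFn_neg f).trans hfg.neg⟩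

theorem IsIncreasing.isDecreasing_of_neg {f : LInf} (hf : IsIncreasing (-f)) :
    IsDecreasing f := by
  simpa using hf.isDecreasing_neg

/-- Applying `T` twice reverses the order twice, yet `T (T f) = T f`. -/
theorem MonotonicityReversing.monotonicityPreserving {T : LInf →ₗ[ℝ] LInf}
    (hT : IsConditionalExpectation T) (h : MonotonicityReversing T) :
    MonotonicityPreserving T := by
  intro f hf
  have := h _ (h f hf).isDecreasing_neg
  rw [map_neg, hT.apply_apply] at this
  exact this.isDecreasing_of_neg

/-! ### Level sets of a monotone function -/

theorem Monotone.Ioo_sInf_sSup_subset_preimage_singleton {α β : Type*} [CompleteLinearOrder α]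
    [PartialOrder β] {h : α → β} (hh : Monotone h) (c : β) :
    Ioo (sInf (h ⁻¹' {c})) (sSup (h ⁻¹' {c})) ⊆ h ⁻¹' {c} := by
  rintro u ⟨hu, hu'⟩
  obtain ⟨x, hx, hxu⟩ := sInf_lt_iff.1 hu
  obtain ⟨y, hy, huy⟩ := lt_sSup_iff.1 hu'
  rw [mem_preimage, mem_singleton_iff] at hx hy ⊢
  exact le_antisymm (hy ▸ hh huy.le) (hx ▸ hh hxu.le)

theorem preimage_singleton_subset_Icc_sInf_sSup {α β : Type*} [CompleteLattice α] (h : α → β) (c : β) :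
    h ⁻¹' {c} ⊆ Icc (sInf (h ⁻¹' {c})) (sSup (h ⁻¹' {c})) :=
  fun _ hx => ⟨sInf_le hx, le_sSup hx⟩

/-- The values of `h` whose level sets contain more than one point. -/
abbrev NontrivialLevel (h : I → ℝ) : Type :=
  {c : ℝ // sInf (h ⁻¹' {c}) < sSup (h ⁻¹' {c})}

/-- The interior of a level set of a monotone function. -/
abbrev levelIoo (h : I → ℝ) (c : ℝ) : Set I := Ioo (sInf (h ⁻¹' {c})) (sSup (h ⁻¹' {c}))

theorem Monotone.pairwise_disjoint_levelIoo {h : I → ℝ} (hh : Monotone h) :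
    Pairwise fun j k : NontrivialLevel h => Disjoint (levelIoo h j) (levelIoo h k) := by
  intro j k hjk
  rw [disjoint_left]
  intro x hx hx'
  have h1 : h x = j := hh.Ioo_sInf_sSup_subset_preimage_singleton _ hx
  have h2 : h x = k := hh.Ioo_sInf_sSup_subset_preimage_singleton _ hx'
  exact hjk (Subtype.ext (h1.symm.trans h2))

theorem Monotone.countable_nontrivialLevel {h : I → ℝ} (hh : Monotone h) :
    Countable (NontrivialLevel h) :=
  Pairwise.countable_of_isOpen_disjoint hh.pairwise_disjoint_levelIoo (fun _ => isOpen_Ioo)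
    fun k => nonempty_Ioo.2 k.2

theorem Monotone.levelIoo_ae_eq {h : I → ℝ} (hh : Monotone h) (c : ℝ) :
    levelIoo h c =ᵐ[volume] h ⁻¹' {c} :=
  Filter.EventuallyLE.antisymm
    (Filter.Eventually.of_forall (hh.Ioo_sInf_sSup_subset_preimage_singleton c))
    (Filter.EventuallyLE.trans
      (Filter.Eventually.of_forall (preimage_singleton_subset_Icc_sInf_sSup h c))
      Ioo_ae_eq_Icc.symm.le)

/-- The two sets differ only at points `x > u` with `h x = h u`. Off the open intervals, such an `x`
can only be the right endpoint of the level set of `h u`, a single point. -/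
theorem Monotone.compl_levelIoo_inter_Iic_ae_eq {h : I → ℝ} (hh : Monotone h) (u : I) :
    ((⋃ c : NontrivialLevel h, levelIoo h c)ᶜ ∩ Iic u : Set I) =ᵐ[volume]
      ((⋃ c : NontrivialLevel h, levelIoo h c)ᶜ ∩ h ⁻¹' Iic (h u) : Set I) := by
  have hne : ∀ᵐ x : I, x ≠ sSup (h ⁻¹' {h u}) := Measure.ae_ne volume _
  rw [Filter.eventuallyEq_set]
  filter_upwards [hne] with x hx
  refine and_congr_right fun hxP => ⟨fun hxu => hh hxu, fun hxu => ?_⟩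
  by_contra hux
  have hux : u < x := not_le.1 hux
  have hxL : x ∈ h ⁻¹' {h u} := le_antisymm hxu (hh hux.le)
  have hux' : sInf (h ⁻¹' {h u}) < x :=
    (preimage_singleton_subset_Icc_sInf_sSup h (h u) rfl).1.trans_lt hux
  have hxs : x < sSup (h ⁻¹' {h u}) :=
    lt_of_le_of_ne (preimage_singleton_subset_Icc_sInf_sSup h (h u) hxL).2 hx
  exact hxP (mem_iUnion_of_mem (⟨h u, hux'.trans hxs⟩ : NontrivialLevel h) ⟨hux', hxs⟩)

/-! ### Lipschitz functions and the image of the identity -/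

theorem Continuous.memLp_top_unitInterval {f : I → ℝ} (hf : Continuous f) :
    MemLp f ∞ (volume : Measure I) := by
  obtain ⟨C, hC⟩ := isCompact_univ.exists_bound_of_continuousOn hf.continuousOn
  exact memLp_top_of_bound hf.aestronglyMeasurable C
    (Filter.Eventually.of_forall fun x => hC x (mem_univ x))

theorem isDecreasing_toLp {f : I → ℝ} (hf : MemLp f ∞ (volume : Measure I)) (h : Antitone f) :
    IsDecreasing (hf.toLp f) :=
  ⟨f, h, hf.coeFn_toLp⟩

theorem continuous_coe_unitInterval : Continuous fun x : I => (x : ℝ) :=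
  continuous_subtype_val

/-- The identity function as an element of `L^∞([0, 1])`. -/
noncomputable def LInf.id : LInf := continuous_coe_unitInterval.memLp_top_unitInterval.toLp _

theorem LipschitzWith.le_add_mul_unitInterval {f : I → ℝ} {L : NNReal} (hL : LipschitzWith L f)
    {x y : I} (hxy : x ≤ y) : |f y - f x| ≤ L * ((y : ℝ) - x) := by
  have := hL.dist_le_mul y x
  rwa [Real.dist_eq, Subtype.dist_eq, Real.dist_eq,
    abs_of_nonneg (sub_nonneg.2 (Subtype.coe_le_coe.2 hxy))] at this

theorem LipschitzWith.antitone_sub_mul_unitInterval {f : I → ℝ} {L : NNReal}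
    (hL : LipschitzWith L f) : Antitone fun x : I => f x - L * (x : ℝ) := by
  intro x y hxy
  have := (abs_le.1 (hL.le_add_mul_unitInterval hxy)).2
  simp only
  linarith

theorem MonotonicityPreserving.exists_monotone_id {T : LInf →ₗ[ℝ] LInf}
    (hT : MonotonicityPreserving T) :
    ∃ h : I → ℝ, Monotone h ∧ (T LInf.id : I → ℝ) =ᵐ[volume] h := by
  obtain ⟨g, hg, hTg⟩ := hT (-LInf.id) (by
    refine IsIncreasing.isDecreasing_neg ⟨_, Subtype.mono_coe _, MemLp.coeFn_toLp _⟩)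
  refine ⟨-g, hg.neg, ?_⟩
  rw [map_neg] at hTg
  filter_upwards [hTg, Lp.coeFn_neg (T LInf.id)] with x hx hx'
  rw [Pi.neg_apply, ← hx, hx', Pi.neg_apply, neg_neg]

/-- On a level set of the image of the identity, a monotonicity preserving operator maps Lipschitz
functions to constants. -/
theorem MonotonicityPreserving.exists_ae_eq_const {T : LInf →ₗ[ℝ] LInf}
    (hT : MonotonicityPreserving T) {A : Set I} {c : ℝ}
    (hA : (T LInf.id : I → ℝ) =ᵐ[volume.restrict A] fun _ => c)
    {f : I → ℝ} {L : NNReal} (hL : LipschitzWith L f) (hf : MemLp f ∞ (volume : Measure I)) :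
    ∃ d : ℝ, (T (hf.toLp f) : I → ℝ) =ᵐ[volume.restrict A] fun _ => d := by
  have key : ∀ (g : I → ℝ) (hg : MemLp g ∞ (volume : Measure I)), LipschitzWith L g →
      ∃ g' : I → ℝ, Antitone g' ∧ (T (hg.toLp g) : I → ℝ) =ᵐ[volume.restrict A] g' := by
    intro g hg hLg
    obtain ⟨g', hg', hTg⟩ := hT (hg.toLp g - (L : ℝ) • LInf.id) (by
      refine ⟨_, hLg.antitone_sub_mul_unitInterval, ?_⟩
      filter_upwards [Lp.coeFn_sub (hg.toLp g) ((L : ℝ) • LInf.id), hg.coeFn_toLp,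
        Lp.coeFn_smul (L : ℝ) LInf.id,
        continuous_coe_unitInterval.memLp_top_unitInterval.coeFn_toLp] with x h1 h2 h3 h4
      rw [h1, Pi.sub_apply, h2, h3, Pi.smul_apply, LInf.id, h4, smul_eq_mul])
    -- On `A` the subtracted term `L • T LInf.id` is the constant `L * c`, so adding it back keeps
    -- the function antitone.
    refine ⟨fun x => g' x + L * c, hg'.add_const _, ?_⟩
    rw [map_sub, map_smul] at hTg
    filter_upwards [ae_restrict_of_ae hTg, hA,
      ae_restrict_of_ae (Lp.coeFn_sub (T (hg.toLp g)) ((L : ℝ) • T LInf.id)),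
      ae_restrict_of_ae (Lp.coeFn_smul (L : ℝ) (T LInf.id))] with x h1 h2 h3 h4
    rw [← h1, h3, Pi.sub_apply, h4, Pi.smul_apply, h2, smul_eq_mul, sub_add_cancel]
  obtain ⟨g₁, hg₁, h₁⟩ := key f hf hL
  obtain ⟨g₂, hg₂, h₂⟩ := key (-f) hf.neg hL.neg
  refine exists_ae_eq_const_of_antitone_of_monotone hg₁ hg₂.neg h₁ ?_
  rw [MemLp.toLp_neg hf, map_neg] at h₂
  filter_upwards [h₂, ae_restrict_of_ae (Lp.coeFn_neg (T (hf.toLp f)))] with x hx hx'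
  change _ = -g₂ x
  rw [← hx, hx', Pi.neg_apply, neg_neg]

/-! ### The complement of the intervals, and the conclusion -/

theorem borel_unitInterval_eq_generateFrom_Iic :
    (Subtype.instMeasurableSpace : MeasurableSpace I) =
      MeasurableSpace.generateFrom (range Iic) :=
  BorelSpace.measurable_eq.trans (borel_eq_generateFrom_Iic I)

/-- A σ-algebra on `[0, 1]` whose trace on a member `s` contains all `s ∩ Iic u` contains
all Borel subsets of `s`. -/
theorem measurableSet_inter_of_forall_Iic {m : MeasurableSpace I} {s : Set I}
    (hs : MeasurableSet[m] s) (h : ∀ u, MeasurableSet[m] (s ∩ Iic u)) {t : Set I}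
    (ht : MeasurableSet[Subtype.instMeasurableSpace] t) : MeasurableSet[m] (s ∩ t) := by
  rw [borel_unitInterval_eq_generateFrom_Iic] at ht
  induction t, ht using MeasurableSpace.generateFrom_induction with
  | hC t ht _ =>
    obtain ⟨u, rfl⟩ := ht
    exact h u
  | empty => rw [inter_empty]; exact @MeasurableSet.empty _ m
  | compl t _ ih =>
    have : s ∩ tᶜ = s \ (s ∩ t) := by rw [sdiff_self_inter, sdiff_eq]
    rw [this]
    exact hs.diff ih
  | iUnion t _ ih =>
    rw [inter_iUnion]
    exact MeasurableSet.iUnion ih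

theorem IsConditionalExpectation.exists_Ioo_of_monotonicityPreserving {T : LInf →ₗ[ℝ] LInf}
    (hT : IsConditionalExpectation T) (hmon : MonotonicityPreserving T) :
    ∃ (ι : Type) (_ : Countable ι) (a b : ι → I),
      (∀ k, a k < b k) ∧
      Pairwise (fun j k => Disjoint (Ioo (a j) (b j)) (Ioo (a k) (b k))) ∧
      ∀ f : LInf, (T f : I → ℝ) =ᵐ[volume] fun u =>
        (∑' k, (Ioo (a k) (b k)).indicator
            (fun _ => 1 / ((b k : ℝ) - (a k : ℝ)) * ∫ t in Ioo (a k) (b k), f t) u) +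
          (⋃ k, Ioo (a k) (b k))ᶜ.indicator (fun v => f v) u := by
  have hint : ∀ f : LInf, Integrable (f : I → ℝ) (volume : Measure I) := fun f =>
    (Lp.memLp f).integrable le_top
  obtain ⟨m, hm, hcomplete, hTm⟩ := hT.exists_complete
  obtain ⟨h, hh, hTh⟩ := hmon.exists_monotone_id
  have hcount := hh.countable_nontrivialLevel
  -- `h` agrees a.e. with an `m`-measurable function, so completeness of `m` makes `h` itself
  -- `m`-measurable.
  have hpre : ∀ s : Set ℝ, MeasurableSet s → MeasurableSet[m] (h ⁻¹' s) := fun s hs =>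
    hcomplete _ _ (hh.measurable hs)
      ((stronglyMeasurable_condExp (m := m) (m₀ := Subtype.instMeasurableSpace) (μ := volume)
        (f := (LInf.id : I → ℝ))).measurable hs)
      ((hTh.symm.trans (hTm _)).preimage s)
  have hIoo : ∀ c, MeasurableSet[m] (levelIoo h c) := fun c =>
    hcomplete _ _ measurableSet_Ioo (hpre _ (measurableSet_singleton c)) (hh.levelIoo_ae_eq c)
  have hP : MeasurableSet[m] (⋃ c : NontrivialLevel h, levelIoo h c)ᶜ :=
    (MeasurableSet.iUnion fun c : NontrivialLevel h => hIoo c).compl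
  have hPt : ∀ t : Set I, MeasurableSet[Subtype.instMeasurableSpace] t →
      MeasurableSet[m] ((⋃ c : NontrivialLevel h, levelIoo h c)ᶜ ∩ t) := fun t ht =>
    measurableSet_inter_of_forall_Iic hP (fun u =>
      hcomplete _ _ ((hm _ hP).inter measurableSet_Iic) (hP.inter (hpre _ measurableSet_Iic))
        (hh.compl_levelIoo_inter_Iic_ae_eq u)) ht
  refine ⟨NontrivialLevel h, hcount, fun c => sInf (h ⁻¹' {c.1}), fun c => sSup (h ⁻¹' {c.1}),
    fun c => c.2, hh.pairwise_disjoint_levelIoo, fun f => ?_⟩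
  have hcompl : (T f : I → ℝ) =ᵐ[volume.restrict (⋃ c : NontrivialLevel h, levelIoo h c)ᶜ] f := by
    refine Filter.EventuallyEq.trans (ae_restrict_of_ae (hTm f)) ?_
    -- On the complement, `m` and the Borel σ-algebra have the same trace, and conditioning on the
    -- latter changes nothing.
    refine (condExp_ae_eq_restrict_of_measurableSpace_eq_on hm le_rfl hP fun t =>
      ⟨fun ht => hm _ ht, fun ht => ?_⟩).trans (Filter.EventuallyEq.of_eq ?_)
    · have := hPt _ ht
      rwa [← inter_assoc, inter_self] at this
    · exact condExp_of_stronglyMeasurable le_rfl (Lp.stronglyMeasurable f) (hint f)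
  have havg : ∀ c : NontrivialLevel h, (T f : I → ℝ) =ᵐ[volume.restrict (levelIoo h c)]
      fun _ => 1 / (((sSup (h ⁻¹' {c.1}) : I) : ℝ) - ((sInf (h ⁻¹' {c.1}) : I) : ℝ)) *
        ∫ t in levelIoo h c, f t := by
    intro c
    refine Filter.EventuallyEq.trans (ae_restrict_of_ae (hTm f)) ?_
    rw [one_div, ← volumeReal_Ioo_unitInterval c.2]
    refine condExp_ae_eq_average_of_forall_lipschitz hm (hIoo c) ?_ (hint f)
    rintro g - ⟨L, hL⟩
    have hg := hL.continuous.memLp_top_unitInterval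
    have hc : (T LInf.id : I → ℝ) =ᵐ[volume.restrict (levelIoo h c)] fun _ => (c : ℝ) := by
      filter_upwards [ae_restrict_of_ae hTh, ae_restrict_mem measurableSet_Ioo] with x hx hxA
      exact hx.trans (hh.Ioo_sInf_sSup_subset_preimage_singleton _ hxA)
    obtain ⟨d, hd⟩ := hmon.exists_ae_eq_const hc hL hg
    exact ⟨hg.integrable le_top, d, Filter.EventuallyEq.trans (ae_restrict_of_ae
      ((condExp_congr_ae hg.coeFn_toLp.symm).trans (hTm _).symm)) hd⟩
  have havg' := ae_all_iff.2 fun c => (ae_restrict_iff' measurableSet_Ioo).1 (havg c)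
  filter_upwards [havg', (ae_restrict_iff' (hm _ hP)).1 hcompl] with u hu hu'
  by_cases huP : u ∈ ⋃ c : NontrivialLevel h, levelIoo h c
  · obtain ⟨c, hc⟩ := mem_iUnion.1 huP
    rw [tsum_indicator_add_indicator_of_mem hh.pairwise_disjoint_levelIoo _ _ hc]
    exact hu c hc
  · rw [tsum_indicator_add_indicator_of_notMem _ _ huP]
    exact hu' huP

theorem mainTheorem4 (T : LInf →ₗ[ℝ] LInf) (hT : IsConditionalExpectation T) :
    (MonotonicityPreserving T ∨ MonotonicityReversing T) ↔
      ∃ (ι : Type) (_ : Countable ι) (a b : ι → I),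
        (∀ k, a k < b k) ∧
        Pairwise (fun j k => Disjoint (Ioo (a j) (b j)) (Ioo (a k) (b k))) ∧
        ∀ f : LInf, (T f : I → ℝ) =ᵐ[volume] fun u =>
          (∑' k, (Ioo (a k) (b k)).indicator
              (fun _ => 1 / ((b k : ℝ) - (a k : ℝ)) * ∫ t in Ioo (a k) (b k), f t) u) +
            (⋃ k, Ioo (a k) (b k))ᶜ.indicator (fun v => f v) u := by
  constructor
  · intro h
    exact hT.exists_Ioo_of_monotonicityPreserving
      (h.elim id fun h' => h'.monotonicityPreserving hT)
  · rintro ⟨ι, _, a, b, hab, hd, hTf⟩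
    exact Or.inl (MonotonicityPreserving.of_average_on_Ioo hab hd hTf)
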